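/- **Setting.** Let $d\ge 0$. A tile is a subset of $\mathbb R^d$ homeomorphic to the closed unit ball, possibly with a label. Let $\{p_i\}_{i\in I}$ be a finite set of prototiles in $\mathbb R^d$, each with a CW structure. All tiles are translates of prototiles and carry the translated CW structure; a *subcell* of a tile is one of its closed cells. A *partial tiling* is a set of tiles any two of which intersect only on their boundaries; its *support* is the union of its tiles; it is a *tiling* if its support is $\mathbb R^d$. For a tiling $T$ and $U\subseteq\mathbb R^d$ let $T(U)$ be the set of tiles of $T$ that meet $U$. A *substitution* $\phi$ with inflation factor $\lambda>1$ assigns to each $p_i$ a partial tiling $\phi(p_i)$ with support $\lambda p_i$; it extends by $\phi(p_i+x)=\phi(p_i)+\lambda x$ and $\phi(T)=\bigcup_{t\in T}\phi(t)$. Let $F=\{\phi_1,\dots,\phi_k\}$ be finitely many substitutions on these prototiles, with inflation factors $\lambda_1,\dots,\lambda_k$, let $s=(s_1,s_2,\dots)\in\{1,\dots,k\}^{\mathbb N}$, and let $\sigma$ be the shift. The *mixed substitution space* $\Omega_{F,s}$ is the set of all tilings $T$ such that every $S\subseteq T$ with bounded support is contained in $\phi_{s_1}\cdots\phi_{s_n}(p_i+u)$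 for some $n$, $i$ and $u\in\mathbb R^d$. **Complexes.** For a set $\Omega$ of tilings, give $\Omega\times\mathbb R^d$ the product topology with $\Omega$ discrete. $AP(\Omega)$ is its quotient by the smallest equivalence relation that equates $(T_1,u_1)$ and $(T_2,u_2)$ whenever there are tiles $u_1\in t_1\in T_1$ and $u_2\in t_2\in T_2$ with the same collared tile in the same position, i.e. $t_1-u_1=t_2-u_2$ and $T_1(t_1)-u_1=T_2(t_2)-u_2$. The modified complex $AP'(\Omega)$ is its quotient by the smallest equivalence relation that equates $(T_1,u_1)$ and $(T_2,u_2)$ whenever there are a subcell $c_1\ni u_1$ of a tile of $T_1$ and a subcell $c_2\ni u_2$ of a tile of $T_2$ with $c_1-u_1=c_2-u_2$ and $T_1(c_1)-u_1=T_2(c_2)-u_2$. **Theorem.** Assume: 1. for every $i\ge1$, $\phi_{s_i}$ is one-to-one on $\Omega_{F,\sigma^i s}$; 2. $(F,s)$ is primitive: there is $n$ such that for all $i,j\in I$ and $m\ge 0$, $\phi_{s_{m+1}}\cdots\phi_{s_{m+n}}(p_i)$ contains a translate of $p_j$; 3. $\Omega_{F,s}$ has finite local complexity: for every $r$, there are,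 up to translation, only finitely many sets $S\subseteq T\in\Omega_{F,s}$ whose support has diameter at most $r$; 4. $F$ is compatible: for all $i$, $n$ and $r_1,\dots,r_n$, the intersection of any tile of $\phi_{r_1}\cdots\phi_{r_n}(p_i)$ with any other tile of it is a union of subcells of the former; and $F$ respects the CW structures: for every $r$ and $i$ and every closed cell $c$ of $p_i$, the set $\lambda_r c$ is a union of subcells of tiles of $\phi_r(p_i)$. Then, for every $i\ge 1$, $(T,u)\mapsto(\phi_{s_i}(T),\lambda_{s_i}u)$ induces well-defined continuous maps $\gamma_i: AP(\Omega_{F,\sigma^i s})\to AP(\Omega_{F,\sigma^{i-1}s})$ and $\gamma_i': AP'(\Omega_{F,\sigma^i s})\to AP'(\Omega_{F,\sigma^{i-1}s})$, and the inverse limits $$\varprojlim_{\gamma_i'}AP'(\Omega_{F,\sigma^i s})\;\cong\;\varprojlim_{\gamma_i}AP(\Omega_{F,\sigma^i s})$$ (over $i\ge 0$) are homeomorphic. -/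

import Mathlib

open Set Topology
open scoped Pointwise

namespace MixedTiling

/-- The Euclidean space `ℝ^d`. -/
abbrev Space (d : ℕ) : Type := EuclideanSpace ℝ (Fin d)

/-- A family of prototiles in `ℝ^d`: subsets homeomorphic to the closed unit ball, each with a
CW structure.  The index of a prototile serves as its label, so that different prototiles may
have the same underlying set. -/
structure Prototiles (d : ℕ) (ι : Type*) where
  carrier : ι → Set (Space d)
  homeo_ball : ∀ i, Nonempty (carrier i ≃ₜ Metric.closedBall (0 : Space d) 1)
  cw : ∀ i, Topology.CWComplex (carrier i)

attribute [instance] Prototiles.cw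

/-- A (labelled) tile that is a translate of a prototile: `⟨i, x⟩` is the tile `p_i + x`. -/
@[ext]
structure Tile (d : ℕ) (ι : Type*) where
  label : ι
  pos : Space d

variable {d : ℕ} {ι κ : Type*}

/-- The translate `t + u` of a tile. -/
def Tile.translate (t : Tile d ι) (u : Space d) : Tile d ι := ⟨t.label, t.pos + u⟩

/-- The translate `T + u` of a set of tiles. -/
def translate (T : Set (Tile d ι)) (u : Space d) : Set (Tile d ι) :=
  (fun t => t.translate u) '' T

namespace Prototiles

variable (P : Prototiles d ι)

/-- The subset of `ℝ^d` occupied by a tile. -/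
def tileSet (t : Tile d ι) : Set (Space d) := (fun y => y + t.pos) '' P.carrier t.label

/-- The (closed) subcells of a tile: the translates of the closed cells of its prototile. -/
def subcells (t : Tile d ι) : Set (Set (Space d)) :=
  {c | ∃ (n : ℕ) (e : Topology.RelCWComplex.cell (P.carrier t.label) n),
    c = (fun y => y + t.pos) '' Topology.RelCWComplex.closedCell n e}

/-- The support of a set of tiles. -/
def support (T : Set (Tile d ι)) : Set (Space d) := ⋃ t ∈ T, P.tileSet t

/-- A partial tiling: any two of its tiles intersect only on their boundaries. -/
def IsPartialTiling (T : Set (Tile d ι)) : Prop :=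
  ∀ t ∈ T, ∀ t' ∈ T, t ≠ t' →
    P.tileSet t ∩ P.tileSet t' ⊆ frontier (P.tileSet t) ∩ frontier (P.tileSet t')

/-- A tiling: a partial tiling with support `ℝ^d`. -/
def IsTiling (T : Set (Tile d ι)) : Prop := P.IsPartialTiling T ∧ P.support T = univ

/-- `T(U)`: the set of the tiles of `T` that meet `U`. -/
def around (T : Set (Tile d ι)) (U : Set (Space d)) : Set (Tile d ι) :=
  {t ∈ T | (P.tileSet t ∩ U).Nonempty}

/-- Finite local complexity of a set of tilings: for every `r`, the patches of diameter at most
`r` that occur in its tilings fall into finitely many classes up to translation. -/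
def FLC (Ω : Set (Set (Tile d ι))) : Prop :=
  ∀ r : ℝ, ∃ Q : Set (Set (Tile d ι)), Q.Finite ∧
    ∀ T ∈ Ω, ∀ S ⊆ T, Bornology.IsBounded (P.support S) → Metric.diam (P.support S) ≤ r →
      ∃ S₀ ∈ Q, ∃ u : Space d, S = translate S₀ u

end Prototiles

/-- A tile substitution with inflation factor `ratio > 1`: every prototile `p_i` is sent to a
partial tiling with support `ratio • p_i`. -/
structure TileSubstitution (P : Prototiles d ι) where
  ratio : ℝ
  one_lt_ratio : 1 < ratio
  img : ι → Set (Tile d ι)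
  isPartialTiling_img : ∀ i, P.IsPartialTiling (img i)
  support_img : ∀ i, P.support (img i) = ratio • P.carrier i

variable {P : Prototiles d ι}

/-- The extension of a substitution to sets of tiles, `φ(p_i + x) = φ(p_i) + ratio • x`. -/
def TileSubstitution.apply (φ : TileSubstitution P) (T : Set (Tile d ι)) : Set (Tile d ι) :=
  ⋃ t ∈ T, translate (φ.img t.label) (φ.ratio • t.pos)

/-- `φ_{r_1} φ_{r_2} ⋯ φ_{r_n}` applied to a set of tiles, for the word `r_1 r_2 ⋯ r_n`. -/
def applyWord (F : κ → TileSubstitution P) : List κ → Set (Tile d ι) → Set (Tile d ι)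
  | [], T => T
  | r :: w, T => (F r).apply (applyWord F w T)

/-- The first `n` letters of a sequence (sequences are indexed from `0`). -/
def prefixWord (s : ℕ → κ) (n : ℕ) : List κ := (List.range n).map s

/-- The iterate `σ^m` of the shift on sequences. -/
def shift (m : ℕ) (s : ℕ → κ) : ℕ → κ := fun j => s (j + m)

/-- The mixed substitution space `Ω_{F,s}`: all tilings `T` by translates of the prototiles such
that every patch of `T` with bounded support is contained in some
`φ_{s_1} ⋯ φ_{s_n}(p_i + u)`. -/
def hull (F : κ → TileSubstitution P) (s : ℕ → κ) : Set (Set (Tile d ι)) :=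
  {T | P.IsTiling T ∧ ∀ S ⊆ T, Bornology.IsBounded (P.support S) →
    ∃ (n : ℕ) (i : ι) (u : Space d), S ⊆ applyWord F (prefixWord s n) {⟨i, u⟩}}

/-- Injectivity: `φ_{s_i}` is one-to-one on `Ω_{F,σ^i s}`, for every `i`. -/
def InjectiveSystem (F : κ → TileSubstitution P) (s : ℕ → κ) : Prop :=
  ∀ i : ℕ, Set.InjOn (F (s i)).apply (hull F (shift (i + 1) s))

/-- Primitivity of `(F, s)`: for some `n`, every `φ_{s_{m+1}} ⋯ φ_{s_{m+n}}(p_i)` contains a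
translate of every `p_j`. -/
def IsPrimitive (F : κ → TileSubstitution P) (s : ℕ → κ) : Prop :=
  ∃ n : ℕ, ∀ (i j : ι) (m : ℕ), ∃ v : Space d,
    (⟨j, v⟩ : Tile d ι) ∈ applyWord F (prefixWord (shift m s) n) {⟨i, 0⟩}

/-- Compatibility of `F`: in every `φ_{r_1} ⋯ φ_{r_n}(p_i)`, the intersection of a
tile with any other tile is a union of subcells of it. -/
def IsCompatible (F : κ → TileSubstitution P) : Prop :=
  ∀ (i : ι) (w : List κ), ∀ t ∈ applyWord F w {⟨i, 0⟩}, ∀ t' ∈ applyWord F w {⟨i, 0⟩}, t ≠ t' →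
    ∃ C ⊆ P.subcells t, P.tileSet t ∩ P.tileSet t' = ⋃₀ C

/-- The substitutions in `F` respect the CW structures of the prototiles: the inflated copy
`λ_r • c` of every closed cell `c` of a prototile `p_i` is a union of subcells of tiles of
`φ_r(p_i)`. -/
def RespectsCells (F : κ → TileSubstitution P) : Prop :=
  ∀ (r : κ) (i : ι), ∀ c ∈ P.subcells ⟨i, 0⟩,
    ∃ C ⊆ ⋃ t ∈ (F r).img i, P.subcells t, (F r).ratio • c = ⋃₀ C

/-- A set `Ω` of tilings as a type, to be given the discrete topology. -/
def Discrete (Ω : Set (Set (Tile d ι))) : Type _ := {T : Set (Tile d ι) // T ∈ Ω}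

instance (Ω : Set (Set (Tile d ι))) : TopologicalSpace (Discrete Ω) := ⊥

variable (P)

/-- The relation generating the Anderson-Putnam complex: `(T₁, u₁)` and `(T₂, u₂)` are related if
`u₁` and `u₂` have the same position in equal collared tiles of `T₁` and `T₂`.  A collared tile is
a tile `t` of a tiling `T` together with its collar `T(t)`. -/
def collarRel (Ω : Set (Set (Tile d ι))) (x y : Discrete Ω × Space d) : Prop :=
  ∃ t₁ ∈ x.1.val, ∃ t₂ ∈ y.1.val, x.2 ∈ P.tileSet t₁ ∧ y.2 ∈ P.tileSet t₂ ∧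
    t₁.translate (-x.2) = t₂.translate (-y.2) ∧
    translate (P.around x.1.val (P.tileSet t₁)) (-x.2) =
      translate (P.around y.1.val (P.tileSet t₂)) (-y.2)

/-- The relation generating the modified Anderson-Putnam complex: as `collarRel`, but with closed
subcells of tiles, and the tiles that meet them, in the place of tiles. -/
def cellCollarRel (Ω : Set (Set (Tile d ι))) (x y : Discrete Ω × Space d) : Prop :=
  ∃ t₁ ∈ x.1.val, ∃ t₂ ∈ y.1.val, ∃ c₁ ∈ P.subcells t₁, ∃ c₂ ∈ P.subcells t₂,
    x.2 ∈ c₁ ∧ y.2 ∈ c₂ ∧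
    (fun z => z - x.2) '' c₁ = (fun z => z - y.2) '' c₂ ∧
    translate (P.around x.1.val c₁) (-x.2) = translate (P.around y.1.val c₂) (-y.2)

/-- The Anderson-Putnam complex `AP(Ω)`: the quotient of `Ω × ℝ^d` (`Ω` discrete) by the smallest
equivalence relation that contains `collarRel`. -/
def AP (Ω : Set (Set (Tile d ι))) : Type _ :=
  Quotient (Relation.EqvGen.setoid (collarRel P Ω))

instance (Ω : Set (Set (Tile d ι))) : TopologicalSpace (AP P Ω) :=
  inferInstanceAs (TopologicalSpace (Quotient (Relation.EqvGen.setoid (collarRel P Ω))))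

/-- The class of `(T, u)` in `AP(Ω)`. -/
def AP.mk {Ω : Set (Set (Tile d ι))} (T : Set (Tile d ι)) (hT : T ∈ Ω) (u : Space d) : AP P Ω :=
  Quotient.mk (Relation.EqvGen.setoid (collarRel P Ω)) (⟨T, hT⟩, u)

/-- The modified Anderson-Putnam complex `AP'(Ω)`: the quotient of `Ω × ℝ^d` (`Ω` discrete) by the
smallest equivalence relation that contains `cellCollarRel`. -/
def ModAP (Ω : Set (Set (Tile d ι))) : Type _ :=
  Quotient (Relation.EqvGen.setoid (cellCollarRel P Ω))

instance (Ω : Set (Set (Tile d ι))) : TopologicalSpace (ModAP P Ω) :=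
  inferInstanceAs (TopologicalSpace (Quotient (Relation.EqvGen.setoid (cellCollarRel P Ω))))

/-- The class of `(T, u)` in `AP'(Ω)`. -/
def ModAP.mk {Ω : Set (Set (Tile d ι))} (T : Set (Tile d ι)) (hT : T ∈ Ω) (u : Space d) :
    ModAP P Ω :=
  Quotient.mk (Relation.EqvGen.setoid (cellCollarRel P Ω)) (⟨T, hT⟩, u)

variable {P}

/-- `φ` maps `Ω₁` into `Ω₀`, and `γ` is the map `(T, u) ↦ (φ(T), ratio • u)` on classes.  (There is
at most one such `γ`.) -/
def IsInducedAP (φ : TileSubstitution P) {Ω₁ Ω₀ : Set (Set (Tile d ι))}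
    (γ : AP P Ω₁ → AP P Ω₀) : Prop :=
  ∀ (T : Set (Tile d ι)) (hT : T ∈ Ω₁), ∃ h : φ.apply T ∈ Ω₀,
    ∀ u : Space d, γ (AP.mk P T hT u) = AP.mk P (φ.apply T) h (φ.ratio • u)

/-- The analogue of `IsInducedAP` for the modified complexes. -/
def IsInducedModAP (φ : TileSubstitution P) {Ω₁ Ω₀ : Set (Set (Tile d ι))}
    (γ : ModAP P Ω₁ → ModAP P Ω₀) : Prop :=
  ∀ (T : Set (Tile d ι)) (hT : T ∈ Ω₁), ∃ h : φ.apply T ∈ Ω₀,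
    ∀ u : Space d, γ (ModAP.mk P T hT u) = ModAP.mk P (φ.apply T) h (φ.ratio • u)

/-- The inverse limit of `X 0 ← X 1 ← X 2 ← ⋯`, with the subspace topology of the product. -/
def InverseLimit {X : ℕ → Type*} [∀ i, TopologicalSpace (X i)]
    (f : ∀ i, C(X (i + 1), X i)) : Set (∀ i, X i) :=
  {x | ∀ i, f i (x (i + 1)) = x i}

end MixedTiling

namespace MixedTiling

/-! A collared tile carries at least as much information as a collared subcell of it, so the
identity on pairs (T, u) induces a projection from AP to AP'. Conversely, inflation turns knowledge
near a subcell into knowledge of a collar. Let δ > 0 be such that every tile coming within δ of a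
subcell c of a tile meets c (`IsCellMargin`). Two tilings that agree on the tiles meeting c ∋ u then
agree on the open δ-ball about u. If D bounds the diameters of tiles and a product of substitutions
has inflation factor λ > D/δ, the images agree on the λδ-ball about λu, which contains any tile
through λu; so the collars of that tile agree. Hence products of k+1 substitutions, k large, induce
maps from AP' to AP that descend k+1 levels (`exists_ModAP_to_AP`). Composed with the projection on
either side they give the bonding maps, so the two systems interleave
(`nonempty_inverseLimit_homeomorph`).

The crux is a single δ for all levels (`exists_uniform_isCellMargin`). By compatibility, the
intersection of two tiles is a union of subcells of each, and a tile has finitely many subcells; so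
touching tiles have finitely many relative positions over all levels together
(`exists_finite_touching`). A margin depends only on the second corona, of which finitely many
remain. That each has a positive margin needs local finiteness, which comes from finite local
complexity at level 0 and is pulled back along the substitutions (`finite_meeting`). -/

/-- A CW complex with compact underlying set has finitely many cells. -/
theorem finite_cells_of_isCompact {X : Type*} [TopologicalSpace X] [T2Space X] (C : Set X)
    [Topology.CWComplex C] (hC : IsCompact C) :
    Finite (Σ n, Topology.RelCWComplex.cell C n) := by
  classical
  set z : (Σ n, Topology.RelCWComplex.cell C n) → X :=
    fun e => Topology.RelCWComplex.map e.1 e.2 0 with hz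
  have hzo : ∀ e, z e ∈ Topology.RelCWComplex.openCell e.1 e.2 := fun e =>
    Topology.RelCWComplex.map_zero_mem_openCell _ _
  have huniq : ∀ e e', z e ∈ Topology.RelCWComplex.openCell e'.1 e'.2 → e = e' := by
    intro e e' h
    by_contra hne
    exact Set.disjoint_left.1 (Topology.RelCWComplex.disjoint_openCell_of_ne
      (i := e.2) (j := e'.2) hne) (hzo e) h
  have hinj : Function.Injective z := fun e e' h => huniq e e' (h ▸ hzo e')
  have hsub : range z ⊆ C := by
    rintro _ ⟨e, rfl⟩
    exact Topology.RelCWComplex.closedCell_subset_complex _ _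
      (Topology.RelCWComplex.map_zero_mem_closedCell _ _)
  -- A closed cell contains finitely many centres: its own, and one for each of the finitely many
  -- open cells covering its frontier. Hence every set of centres is closed in the weak topology.
  have hclosed : ∀ A ⊆ range z, IsClosed A := by
    intro A hA
    refine (Topology.CWComplex.closed C A (hA.trans hsub)).2 fun n j => ?_
    obtain ⟨I, hI⟩ := Topology.CWComplex.cellFrontier_subset_finite_openCell n j
    have hfin : (⋃ m ∈ Finset.range n, ⋃ i ∈ I m, ({z ⟨m, i⟩} : Set X)).Finite := by
      refine Set.Finite.biUnion (Finset.finite_toSet _) fun m _ => ?_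
      exact Set.Finite.biUnion (Finset.finite_toSet _) fun i _ => Set.finite_singleton _
    refine ((hfin.insert (z ⟨n, j⟩)).subset ?_).isClosed
    rintro x ⟨hxA, hx⟩
    obtain ⟨e, rfl⟩ := hA hxA
    rw [← Topology.RelCWComplex.cellFrontier_union_openCell_eq_closedCell] at hx
    rcases hx with hx | hx
    · right
      have := hI hx
      simp only [mem_iUnion] at this ⊢
      obtain ⟨m, hm, i, hi, h⟩ := this
      refine ⟨m, Finset.mem_range.2 hm, i, hi, ?_⟩
      rw [huniq e ⟨m, i⟩ h]
      rfl
    · left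
      rw [huniq e ⟨n, j⟩ hx]
  by_contra hinf
  rw [not_finite_iff_infinite] at hinf
  obtain ⟨x, -, hx⟩ :=
    (Set.infinite_range_of_injective hinj).exists_accPt_of_subset_isCompact hC hsub
  have h1 := hclosed (range z \ {x}) sdiff_subset
  rw [accPt_principal_iff_clusterPt, ← mem_closure_iff_clusterPt, h1.closure_eq] at hx
  exact hx.2 rfl

/-! ### Translates of tiles and their subcells -/

variable {d : ℕ} {ι κ : Type*}

@[simp] theorem Tile.translate_label (t : Tile d ι) (u : Space d) :
    (t.translate u).label = t.label := rfl

@[simp] theorem Tile.translate_pos (t : Tile d ι) (u : Space d) :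
    (t.translate u).pos = t.pos + u := rfl

@[simp] theorem Tile.translate_translate (t : Tile d ι) (u v : Space d) :
    (t.translate u).translate v = t.translate (u + v) := by
  ext1 <;> simp [add_assoc]

@[simp] theorem Tile.translate_zero (t : Tile d ι) : t.translate 0 = t := by
  ext1 <;> simp

theorem mem_translate {T : Set (Tile d ι)} {u : Space d} {t : Tile d ι} :
    t ∈ translate T u ↔ t.translate (-u) ∈ T := by
  constructor
  · rintro ⟨t, ht, rfl⟩
    simpa using ht
  · intro h
    exact ⟨_, h, by simp⟩

theorem translate_mem_translate {T : Set (Tile d ι)} {t : Tile d ι} (h : t ∈ T) (u : Space d) :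
    t.translate u ∈ translate T u := ⟨t, h, rfl⟩

namespace Prototiles

variable (P : Prototiles d ι)

theorem mem_tileSet {t : Tile d ι} {x : Space d} :
    x ∈ P.tileSet t ↔ x - t.pos ∈ P.carrier t.label := by
  constructor
  · rintro ⟨y, hy, rfl⟩
    simpa using hy
  · intro h
    exact ⟨_, h, by simp⟩

theorem mem_tileSet_translate {t : Tile d ι} {x u : Space d} :
    x ∈ P.tileSet (t.translate u) ↔ x - u ∈ P.tileSet t := by
  rw [mem_tileSet, mem_tileSet, Tile.translate_label, Tile.translate_pos]
  rw [show x - (t.pos + u) = x - u - t.pos by abel]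

theorem add_mem_tileSet_translate {t : Tile d ι} {x u : Space d} (h : x ∈ P.tileSet t) :
    x + u ∈ P.tileSet (t.translate u) := by
  rw [mem_tileSet_translate]; simpa using h

theorem isCompact_carrier (i : ι) : IsCompact (P.carrier i) := by
  obtain ⟨h⟩ := P.homeo_ball i
  have : CompactSpace (Metric.closedBall (0 : Space d) 1) :=
    isCompact_iff_compactSpace.1 (isCompact_closedBall _ _)
  have := h.symm.compactSpace
  exact isCompact_iff_compactSpace.2 this

theorem carrier_nonempty (i : ι) : (P.carrier i).Nonempty := by
  obtain ⟨h⟩ := P.homeo_ball i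
  exact ⟨_, (h.symm ⟨0, by simp⟩).2⟩

theorem isCompact_tileSet (t : Tile d ι) : IsCompact (P.tileSet t) :=
  (P.isCompact_carrier _).image (by fun_prop)

theorem tileSet_nonempty (t : Tile d ι) : (P.tileSet t).Nonempty :=
  (P.carrier_nonempty _).image _

/-- A common bound for the diameters of the prototiles. -/
theorem exists_dist_le [Finite ι] : ∃ D : ℝ, 0 < D ∧
    ∀ t : Tile d ι, ∀ x ∈ P.tileSet t, ∀ y ∈ P.tileSet t, dist x y ≤ D := by
  have hfin : (Set.range fun i => Metric.diam (P.carrier i)).Finite := Set.finite_range _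
  obtain ⟨D, hD⟩ := hfin.bddAbove
  refine ⟨max D 1, by positivity, fun t x hx y hy => ?_⟩
  rw [mem_tileSet] at hx hy
  calc dist x y = dist (x - t.pos) (y - t.pos) := (dist_sub_right _ _ _).symm
    _ ≤ Metric.diam (P.carrier t.label) :=
      Metric.dist_le_diam_of_mem (P.isCompact_carrier _).isBounded hx hy
    _ ≤ max D 1 := (hD ⟨_, rfl⟩).trans (le_max_left _ _)

theorem finite_subcells (t : Tile d ι) : (P.subcells t).Finite := by
  have := finite_cells_of_isCompact (P.carrier t.label) (P.isCompact_carrier _)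
  refine (Set.finite_range fun e : (Σ n, Topology.RelCWComplex.cell (P.carrier t.label) n) =>
    (fun y => y + t.pos) '' Topology.RelCWComplex.closedCell e.1 e.2).subset ?_
  rintro c ⟨n, e, rfl⟩
  exact ⟨⟨n, e⟩, rfl⟩

variable {P}

theorem subset_of_mem_subcells {t : Tile d ι} {c : Set (Space d)} (h : c ∈ P.subcells t) :
    c ⊆ P.tileSet t := by
  obtain ⟨n, e, rfl⟩ := h
  exact image_mono (Topology.RelCWComplex.closedCell_subset_complex _ _)

theorem isCompact_of_mem_subcells {t : Tile d ι} {c : Set (Space d)} (h : c ∈ P.subcells t) :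
    IsCompact c := by
  obtain ⟨n, e, rfl⟩ := h
  exact Topology.RelCWComplex.isCompact_closedCell.image (by fun_prop)

theorem exists_mem_subcells {t : Tile d ι} {x : Space d} (h : x ∈ P.tileSet t) :
    ∃ c ∈ P.subcells t, x ∈ c := by
  obtain ⟨y, hy, rfl⟩ := h
  rw [← Topology.CWComplex.union (C := P.carrier t.label)] at hy
  simp only [mem_iUnion] at hy
  obtain ⟨n, e, he⟩ := hy
  exact ⟨_, ⟨n, e, rfl⟩, y, he, rfl⟩

theorem image_add_mem_subcells {t : Tile d ι} {c : Set (Space d)} (h : c ∈ P.subcells t)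
    (u : Space d) : (fun y => y + u) '' c ∈ P.subcells (t.translate u) := by
  obtain ⟨n, e, rfl⟩ := h
  refine ⟨n, e, ?_⟩
  rw [image_image]
  simp only [Tile.translate_pos, add_assoc]
  rfl

theorem mem_support {T : Set (Tile d ι)} {x : Space d} :
    x ∈ P.support T ↔ ∃ t ∈ T, x ∈ P.tileSet t := by
  simp [support]

theorem IsTiling.exists_mem {T : Set (Tile d ι)} (h : P.IsTiling T) (x : Space d) :
    ∃ t ∈ T, x ∈ P.tileSet t := mem_support.1 (h.2 ▸ mem_univ x)

end Prototiles

/-! ### Substitutions acting on partial tilings -/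

variable {P : Prototiles d ι}

namespace TileSubstitution

variable (φ : TileSubstitution P)

theorem ratio_pos : 0 < φ.ratio := one_pos.trans φ.one_lt_ratio

/-- The tiles that a substitution puts in the place of a tile. -/
def descendants (t : Tile d ι) : Set (Tile d ι) :=
  translate (φ.img t.label) (φ.ratio • t.pos)

theorem mem_apply {T : Set (Tile d ι)} {a : Tile d ι} :
    a ∈ φ.apply T ↔ ∃ t ∈ T, a ∈ φ.descendants t := by
  simp [apply, descendants]

theorem mem_descendants {a t : Tile d ι} :
    a ∈ φ.descendants t ↔ a.translate (-(φ.ratio • t.pos)) ∈ φ.img t.label := mem_translate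

theorem translate_mem_descendants {a t : Tile d ι} (h : a ∈ φ.descendants t) (u : Space d) :
    a.translate (φ.ratio • u) ∈ φ.descendants (t.translate u) := by
  rw [mem_descendants] at h ⊢
  simpa [smul_add] using h

theorem apply_mono {S T : Set (Tile d ι)} (h : S ⊆ T) : φ.apply S ⊆ φ.apply T :=
  biUnion_subset_biUnion_left h

theorem apply_translate (T : Set (Tile d ι)) (u : Space d) :
    φ.apply (translate T u) = translate (φ.apply T) (φ.ratio • u) := by
  ext a
  simp only [mem_translate, mem_apply]
  constructor
  · rintro ⟨t, ht, ha⟩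
    exact ⟨_, ht, by simpa using φ.translate_mem_descendants ha (-u)⟩
  · rintro ⟨t, ht, ha⟩
    exact ⟨t.translate u, by simpa using ht, by simpa using φ.translate_mem_descendants ha u⟩

theorem mem_support_img_iff {i : ι} {x : Space d} :
    (∃ a ∈ φ.img i, φ.ratio • x ∈ P.tileSet a) ↔ x ∈ P.carrier i := by
  rw [← Prototiles.mem_support, φ.support_img, smul_mem_smul_set_iff₀ φ.ratio_pos.ne']

theorem mem_tileSet_iff {t : Tile d ι} {x : Space d} :
    x ∈ P.tileSet t ↔ ∃ a ∈ φ.descendants t, φ.ratio • x ∈ P.tileSet a := by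
  rw [Prototiles.mem_tileSet, ← φ.mem_support_img_iff]
  constructor
  · rintro ⟨a, ha, hx⟩
    refine ⟨_, translate_mem_translate ha _, ?_⟩
    rw [Prototiles.mem_tileSet_translate, ← smul_sub]
    exact hx
  · rintro ⟨a, ha, hx⟩
    refine ⟨_, φ.mem_descendants.1 ha, ?_⟩
    rw [Prototiles.mem_tileSet_translate, smul_sub]
    simpa using hx

theorem mem_tileSet_of_mem_descendants {a t : Tile d ι} (h : a ∈ φ.descendants t) {x : Space d}
    (hx : φ.ratio • x ∈ P.tileSet a) : x ∈ P.tileSet t :=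
  φ.mem_tileSet_iff.2 ⟨a, h, hx⟩

theorem exists_smul_of_mem_descendants {a t : Tile d ι} (h : a ∈ φ.descendants t) {y : Space d}
    (hy : y ∈ P.tileSet a) : ∃ x ∈ P.tileSet t, y = φ.ratio • x := by
  have hxy : y = φ.ratio • φ.ratio⁻¹ • y := (smul_inv_smul₀ φ.ratio_pos.ne' y).symm
  exact ⟨φ.ratio⁻¹ • y, φ.mem_tileSet_of_mem_descendants h (hxy ▸ hy), hxy⟩

theorem tileSet_subset_smul {a t : Tile d ι} (h : a ∈ φ.descendants t) :
    P.tileSet a ⊆ φ.ratio • P.tileSet t := by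
  intro y hy
  obtain ⟨x, hx, rfl⟩ := φ.exists_smul_of_mem_descendants h hy
  exact smul_mem_smul_set hx

theorem isPartialTiling_descendants (t : Tile d ι) : P.IsPartialTiling (φ.descendants t) := by
  rintro _ ⟨a, ha, rfl⟩ _ ⟨b, hb, rfl⟩ hab
  have key : ∀ a : Tile d ι, ∀ v, P.tileSet (a.translate v) = Homeomorph.addRight v '' P.tileSet a := by
    intro a v
    ext x
    rw [P.mem_tileSet_translate]
    simp [sub_eq_add_neg]
  rw [key, key, ← Homeomorph.image_frontier, ← Homeomorph.image_frontier,
    ← image_inter (Homeomorph.injective _), ← image_inter (Homeomorph.injective _)]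
  exact image_mono (φ.isPartialTiling_img _ a ha b hb fun h => hab (h ▸ rfl))

/-- Descendants of distinct tiles t, t' meet only in inflated points of t ∩ t', which are boundary
points of both. Since a descendant of t lies in λt, its interior lies in that of λt, so it can meet
the boundary of λt only in its own boundary. -/
theorem isPartialTiling_apply {T : Set (Tile d ι)} (hT : P.IsPartialTiling T) :
    P.IsPartialTiling (φ.apply T) := by
  intro a ha b hb hab
  obtain ⟨t, ht, hat⟩ := φ.mem_apply.1 ha
  obtain ⟨t', ht', hbt⟩ := φ.mem_apply.1 hb
  by_cases h : t = t'
  · subst h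
    exact φ.isPartialTiling_descendants t a hat b hbt hab
  have key : ∀ {a t : Tile d ι} {x : Space d}, a ∈ φ.descendants t → x ∈ frontier (P.tileSet t) →
      φ.ratio • x ∈ P.tileSet a → φ.ratio • x ∈ frontier (P.tileSet a) := by
    intro a t x hat hx hxa
    refine ⟨subset_closure hxa, fun hi => hx.2 ?_⟩
    have := interior_mono (φ.tileSet_subset_smul hat) hi
    rwa [interior_smul₀ φ.ratio_pos.ne', smul_mem_smul_set_iff₀ φ.ratio_pos.ne'] at this
  rintro y ⟨hya, hyb⟩
  obtain ⟨x, hx, rfl⟩ := φ.exists_smul_of_mem_descendants hat hya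
  have := hT t ht t' ht' h ⟨hx, φ.mem_tileSet_of_mem_descendants hbt hyb⟩
  exact ⟨key hat this.1 hya, key hbt this.2 hyb⟩

theorem support_apply (T : Set (Tile d ι)) :
    P.support (φ.apply T) = φ.ratio • P.support T := by
  ext y
  rw [mem_smul_set_iff_inv_smul_mem₀ φ.ratio_pos.ne', Prototiles.mem_support,
    Prototiles.mem_support]
  constructor
  · rintro ⟨a, ha, hy⟩
    obtain ⟨t, ht, hat⟩ := φ.mem_apply.1 ha
    exact ⟨t, ht, φ.mem_tileSet_iff.2 ⟨a, hat, by rwa [smul_inv_smul₀ φ.ratio_pos.ne']⟩⟩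
  · rintro ⟨t, ht, hy⟩
    obtain ⟨a, hat, ha⟩ := φ.mem_tileSet_iff.1 hy
    exact ⟨a, φ.mem_apply.2 ⟨t, ht, hat⟩, by rwa [smul_inv_smul₀ φ.ratio_pos.ne'] at ha⟩

theorem isTiling_apply {T : Set (Tile d ι)} (hT : P.IsTiling T) : P.IsTiling (φ.apply T) :=
  ⟨φ.isPartialTiling_apply hT.1, by
    rw [support_apply, hT.2, smul_set_univ₀ φ.ratio_pos.ne']⟩

/-- The composition `φ ∘ ψ` of two substitutions. -/
def comp (ψ : TileSubstitution P) : TileSubstitution P where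
  ratio := φ.ratio * ψ.ratio
  one_lt_ratio := one_lt_mul_of_lt_of_le φ.one_lt_ratio ψ.one_lt_ratio.le
  img i := φ.apply (ψ.img i)
  isPartialTiling_img i := φ.isPartialTiling_apply (ψ.isPartialTiling_img i)
  support_img i := by rw [support_apply, ψ.support_img, smul_smul]

theorem comp_apply (ψ : TileSubstitution P) (T : Set (Tile d ι)) :
    (φ.comp ψ).apply T = φ.apply (ψ.apply T) := by
  ext a
  have h : ∀ t, (φ.comp ψ).descendants t = φ.apply (ψ.descendants t) := fun t => by
    rw [descendants, descendants, apply_translate, smul_smul]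
    rfl
  simp only [mem_apply, h]
  exact ⟨fun ⟨t, ht, b, hb, ha⟩ => ⟨b, ⟨t, ht, hb⟩, ha⟩,
    fun ⟨b, ⟨t, ht, hb⟩, ha⟩ => ⟨t, ht, b, hb, ha⟩⟩

end TileSubstitution

/-! ### Substitutions between the spaces of successive shifts -/

theorem shift_succ_apply (F : κ → TileSubstitution P) (s : ℕ → κ) (m n : ℕ) (S : Set (Tile d ι)) :
    (F (s m)).apply (applyWord F (prefixWord (shift (m + 1) s) n) S) =
      applyWord F (prefixWord (shift m s) (n + 1)) S := by
  have : prefixWord (shift m s) (n + 1) = s m :: prefixWord (shift (m + 1) s) n := by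
    rw [prefixWord, List.range_succ_eq_map, List.map_cons, List.map_map, prefixWord]
    simp [shift, Function.comp_def, add_assoc, add_comm 1 m]
  rw [this]
  rfl

/-- A bounded patch S of φ(T) descends from the tiles of T with a descendant in S. These stay within
D of the deflated support of S, hence form a bounded patch of T; a supertile containing it is sent
by φ to one containing S. -/
theorem apply_mem_hull [Finite ι] {F : κ → TileSubstitution P} {s : ℕ → κ} {m : ℕ}
    {T : Set (Tile d ι)} (hT : T ∈ hull F (shift (m + 1) s)) :
    (F (s m)).apply T ∈ hull F (shift m s) := by
  refine ⟨(F (s m)).isTiling_apply hT.1, fun S hS hb => ?_⟩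
  set φ := F (s m) with hφ
  obtain ⟨D, hD0, hD⟩ := P.exists_dist_le
  set S' : Set (Tile d ι) := {t ∈ T | ∃ a ∈ S, a ∈ φ.descendants t} with hS'
  have hb' : Bornology.IsBounded (P.support S') := by
    have hb2 : Bornology.IsBounded (φ.ratio⁻¹ • P.support S) := hb.smul₀ _
    refine (hb2.cthickening (δ := D)).subset fun x hx => ?_
    obtain ⟨t, ⟨-, a, ha, hat⟩, hx⟩ := Prototiles.mem_support.1 hx
    obtain ⟨y, hy⟩ := P.tileSet_nonempty a
    obtain ⟨z, hz, rfl⟩ := φ.exists_smul_of_mem_descendants hat hy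
    refine Metric.mem_cthickening_of_dist_le x z D _ ?_ (hD t x hx z hz)
    rw [mem_inv_smul_set_iff₀ φ.ratio_pos.ne']
    exact Prototiles.mem_support.2 ⟨a, ha, hy⟩
  obtain ⟨n, i, u, h⟩ := hT.2 S' (fun t ht => ht.1) hb'
  refine ⟨n + 1, i, u, ?_⟩
  rw [← shift_succ_apply]
  refine Subset.trans (fun a ha => ?_) (φ.apply_mono h)
  obtain ⟨t, ht, hat⟩ := φ.mem_apply.1 (hS ha)
  exact φ.mem_apply.2 ⟨t, ⟨ht, a, ha, hat⟩, hat⟩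

/-! ### Agreement of tilings and the generating relations -/

/-- The tiles of `T₁` that meet `U` and the tiles of `T₂` that meet `U + v` correspond under
translation by `v`. -/
def Agree (P : Prototiles d ι) (T₁ : Set (Tile d ι)) (U : Set (Space d)) (T₂ : Set (Tile d ι))
    (v : Space d) : Prop :=
  (∀ t ∈ T₁, (∃ z ∈ P.tileSet t, z ∈ U) → t.translate v ∈ T₂) ∧
    ∀ t ∈ T₂, (∃ z ∈ P.tileSet t, z - v ∈ U) → t.translate (-v) ∈ T₁

theorem Agree.mono {T₁ T₂ : Set (Tile d ι)} {U V : Set (Space d)} {v : Space d}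
    (h : Agree P T₁ V T₂ v) (hUV : U ⊆ V) : Agree P T₁ U T₂ v :=
  ⟨fun t ht ⟨z, hz, hzU⟩ => h.1 t ht ⟨z, hz, hUV hzU⟩,
    fun t ht ⟨z, hz, hzU⟩ => h.2 t ht ⟨z, hz, hUV hzU⟩⟩

theorem translate_around_eq_iff {T₁ T₂ : Set (Tile d ι)} {U : Set (Space d)} {u₁ u₂ : Space d} :
    translate (P.around T₁ U) (-u₁) =
        translate (P.around T₂ ((fun y => y + (u₂ - u₁)) '' U)) (-u₂) ↔
      Agree P T₁ U T₂ (u₂ - u₁) := by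
  have himg : ∀ z, z ∈ (fun y => y + (u₂ - u₁)) '' U ↔ z - (u₂ - u₁) ∈ U := by
    intro z
    constructor
    · rintro ⟨y, hy, rfl⟩
      simpa using hy
    · intro h
      exact ⟨_, h, by simp⟩
  constructor
  · intro h
    refine ⟨fun t ht ⟨z, hz, hzU⟩ => ?_, fun t ht ⟨z, hz, hzU⟩ => ?_⟩
    · have : t.translate (-u₁) ∈ translate (P.around T₁ U) (-u₁) :=
        translate_mem_translate (T := P.around T₁ U) ⟨ht, z, hz, hzU⟩ _
      rw [h, mem_translate] at this
      have := this.1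
      rwa [Tile.translate_translate, show -u₁ + - -u₂ = u₂ - u₁ by abel] at this
    · have : t.translate (-u₂) ∈
          translate (P.around T₂ ((fun y => y + (u₂ - u₁)) '' U)) (-u₂) :=
        translate_mem_translate (T := P.around T₂ _) ⟨ht, z, hz, (himg z).2 hzU⟩ _
      rw [← h, mem_translate] at this
      have := this.1
      rwa [Tile.translate_translate, show -u₂ + - -u₁ = -(u₂ - u₁) by abel] at this
  · intro h
    ext t
    rw [mem_translate, mem_translate]
    constructor
    · rintro ⟨ht, z, hz, hzU⟩
      have h1 := h.1 _ ht ⟨z, hz, hzU⟩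
      have h2 := P.add_mem_tileSet_translate hz (u := u₂ - u₁)
      rw [Tile.translate_translate, show - -u₁ + (u₂ - u₁) = - -u₂ by abel] at h1 h2
      exact ⟨h1, _, h2, z, hzU, rfl⟩
    · rintro ⟨ht, z, hz, hzU⟩
      rw [himg] at hzU
      have h1 := h.2 _ ht ⟨z, hz, hzU⟩
      have h2 := P.add_mem_tileSet_translate hz (u := -(u₂ - u₁))
      rw [Tile.translate_translate, show - -u₂ + -(u₂ - u₁) = - -u₁ by abel] at h1 h2
      exact ⟨h1, _, h2, by rwa [← sub_eq_add_neg]⟩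

/-- The second tile is forced to be the translate of the first by the difference of the base points,
and agreement already places it in the second tiling, since a tile meets itself. -/
theorem collarRel_iff {Ω : Set (Set (Tile d ι))} {x y : Discrete Ω × Space d} :
    collarRel P Ω x y ↔ ∃ t ∈ x.1.val, x.2 ∈ P.tileSet t ∧
      Agree P x.1.val (P.tileSet t) y.1.val (y.2 - x.2) := by
  have key : ∀ t : Tile d ι, P.tileSet (t.translate (y.2 - x.2)) =
      (fun z => z + (y.2 - x.2)) '' P.tileSet t := by
    intro t
    ext z
    rw [P.mem_tileSet_translate]
    exact ⟨fun h => ⟨_, h, by simp⟩, by rintro ⟨w, hw, rfl⟩; simpa using hw⟩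
  constructor
  · rintro ⟨t₁, ht₁, t₂, ht₂, hx, hy, ht, h⟩
    have : t₂ = t₁.translate (y.2 - x.2) := by
      have := congrArg (fun t => Tile.translate t y.2) ht
      simp only [Tile.translate_translate, neg_add_cancel, Tile.translate_zero] at this
      rw [← this, neg_add_eq_sub]
    rw [this, key, translate_around_eq_iff] at h
    exact ⟨t₁, ht₁, hx, h⟩
  · rintro ⟨t, ht, hx, h⟩
    refine ⟨t, ht, _, h.1 t ht ⟨_, hx, hx⟩, hx, ?_, ?_, ?_⟩
    · simpa [P.mem_tileSet_translate] using hx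
    · rw [Tile.translate_translate, show y.2 - x.2 + -y.2 = -x.2 by abel]
    · rw [key, translate_around_eq_iff]
      exact h

theorem cellCollarRel_iff {Ω : Set (Set (Tile d ι))} {x y : Discrete Ω × Space d} :
    cellCollarRel P Ω x y ↔ ∃ t ∈ x.1.val, ∃ c ∈ P.subcells t, x.2 ∈ c ∧
      Agree P x.1.val c y.1.val (y.2 - x.2) := by
  constructor
  · rintro ⟨t₁, ht₁, t₂, ht₂, c₁, hc₁, c₂, hc₂, hx, hy, hc, h⟩
    have : c₂ = (fun z => z + (y.2 - x.2)) '' c₁ := by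
      have := congrArg (fun c => (fun z => z + y.2) '' c) hc
      simp only [image_image, sub_add_cancel, image_id'] at this
      rw [← this]
      congr 1
      funext z
      abel
    rw [this, translate_around_eq_iff] at h
    exact ⟨t₁, ht₁, c₁, hc₁, hx, h⟩
  · rintro ⟨t, ht, c, hc, hx, h⟩
    have hx' := Prototiles.subset_of_mem_subcells hc hx
    refine ⟨t, ht, _, h.1 t ht ⟨_, hx', hx⟩, c, hc, _,
      Prototiles.image_add_mem_subcells hc _, hx, ⟨x.2, hx, by simp⟩, ?_,
      translate_around_eq_iff.2 h⟩
    rw [image_image]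
    congr 1
    funext z
    abel

/-- Agreement of two tilings on `U` passes to their substitutes on `V`, if only the descendants of
tiles that meet `U` can meet `V`. -/
theorem Agree.apply (φ : TileSubstitution P) {T₁ T₂ : Set (Tile d ι)} {U V : Set (Space d)}
    {v : Space d} (h : Agree P T₁ U T₂ v)
    (h₁ : ∀ t ∈ T₁, (∃ z ∈ P.tileSet t, φ.ratio • z ∈ V) → ∃ z ∈ P.tileSet t, z ∈ U)
    (h₂ : ∀ t ∈ T₂, (∃ z ∈ P.tileSet t, φ.ratio • (z - v) ∈ V) → ∃ z ∈ P.tileSet t, z - v ∈ U) :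
    Agree P (φ.apply T₁) V (φ.apply T₂) (φ.ratio • v) := by
  constructor
  · rintro a ha ⟨z, hz, hzV⟩
    obtain ⟨t, ht, hat⟩ := φ.mem_apply.1 ha
    obtain ⟨w, hw, rfl⟩ := φ.exists_smul_of_mem_descendants hat hz
    exact φ.mem_apply.2 ⟨_, h.1 t ht (h₁ t ht ⟨w, hw, hzV⟩), φ.translate_mem_descendants hat v⟩
  · rintro a ha ⟨z, hz, hzV⟩
    obtain ⟨t, ht, hat⟩ := φ.mem_apply.1 ha
    obtain ⟨w, hw, rfl⟩ := φ.exists_smul_of_mem_descendants hat hz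
    rw [← smul_sub] at hzV
    rw [← smul_neg]
    exact φ.mem_apply.2 ⟨_, h.2 t ht (h₂ t ht ⟨w, hw, hzV⟩), φ.translate_mem_descendants hat (-v)⟩

theorem Agree.apply_of_subset_smul (φ : TileSubstitution P) {T₁ T₂ : Set (Tile d ι)}
    {U V : Set (Space d)} {v : Space d} (h : Agree P T₁ U T₂ v) (hV : V ⊆ φ.ratio • U) :
    Agree P (φ.apply T₁) V (φ.apply T₂) (φ.ratio • v) := by
  refine h.apply φ (fun t _ ⟨z, hz, hzV⟩ => ⟨z, hz, ?_⟩) (fun t _ ⟨z, hz, hzV⟩ => ⟨z, hz, ?_⟩) <;>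
  exact (smul_mem_smul_set_iff₀ φ.ratio_pos.ne' _ _).1 (hV hzV)

/-! ### Touching pairs and local finiteness -/

theorem applyWord_translate (F : κ → TileSubstitution P) (w : List κ) (T : Set (Tile d ι))
    (u : Space d) : ∃ v, applyWord F w (translate T u) = translate (applyWord F w T) v := by
  induction w with
  | nil => exact ⟨u, rfl⟩
  | cons r w ih =>
    obtain ⟨v, hv⟩ := ih
    exact ⟨(F r).ratio • v, by rw [applyWord, hv, TileSubstitution.apply_translate]; rfl⟩

/-- A nonempty bounded set is not a nontrivial translate of itself. -/
theorem eq_of_image_add_eq {E : Type*} [NormedAddCommGroup E] [NormedSpace ℝ E] {A : Set E}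
    (hA : Bornology.IsBounded A) (hne : A.Nonempty) {x y : E}
    (h : (fun z => z + x) '' A = (fun z => z + y) '' A) : x = y := by
  obtain ⟨a, ha⟩ := hne
  have hstep : ∀ z ∈ A, z + (x - y) ∈ A := by
    intro z hz
    obtain ⟨w, hw, hwz⟩ := h ▸ mem_image_of_mem (fun z => z + x) hz
    have : z + (x - y) = w := by
      rw [← add_sub_assoc, sub_eq_iff_eq_add]
      exact hwz.symm
    exact this ▸ hw
  -- Iterating the translation by x − y from a stays in A, which is unbounded unless x = y.
  have hn : ∀ n : ℕ, a + (n : ℝ) • (x - y) ∈ A := by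
    intro n
    induction n with
    | zero => simpa using ha
    | succ n ih => simpa [add_smul, add_assoc] using hstep _ ih
  obtain ⟨R, hR⟩ := hA.exists_norm_le
  by_contra hxy
  have hpos : 0 < ‖x - y‖ := norm_pos_iff.2 (sub_ne_zero.2 hxy)
  obtain ⟨n, hn'⟩ := exists_nat_gt ((R + ‖a‖) / ‖x - y‖)
  rw [div_lt_iff₀ hpos] at hn'
  have h1 := hR _ (hn n)
  have h2 : ‖(n : ℝ) • (x - y)‖ = n * ‖x - y‖ := by simp [norm_smul]
  have h3 := norm_sub_le (a + (n : ℝ) • (x - y)) a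
  rw [add_sub_cancel_left, h2] at h3
  linarith

theorem exists_sUnion_subcells {t : Tile d ι} {C : Set (Set (Space d))} (hC : C ⊆ P.subcells t) :
    ∃ C₀ ⊆ P.subcells ⟨t.label, 0⟩, ⋃₀ C₀ = (fun z => z + -t.pos) '' ⋃₀ C := by
  refine ⟨image (fun z => z + -t.pos) '' C, ?_, ?_⟩
  · rintro _ ⟨c, hc, rfl⟩
    have := Prototiles.image_add_mem_subcells (hC hc) (-t.pos)
    rwa [show t.translate (-t.pos) = ⟨t.label, 0⟩ by ext1 <;> simp] at this
  · rw [image_sUnion]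

/-- In the tilings of all spaces `Ω_{F,σ^m s}` together, there are only finitely many pairs of
touching tiles up to translation. -/
theorem exists_finite_touching [Finite ι] {F : κ → TileSubstitution P} (s : ℕ → κ)
    (h_comp : IsCompatible F) :
    ∃ N : Set (Tile d ι), N.Finite ∧ ∀ m, ∀ T ∈ hull F (shift m s), ∀ t ∈ T, ∀ t' ∈ T,
      (∃ z ∈ P.tileSet t, z ∈ P.tileSet t') → t'.translate (-t.pos) ∈ N := by
  -- The intersection of touching tiles, seen from either one, is one of finitely many unions of
  -- subcells of its prototile. The two views A and A' differ by the relative position of the tiles,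
  -- which is unique because A' is bounded and nonempty.
  set B : ι → Set (Set (Space d)) := fun i => sUnion '' (𝒫 (P.subcells ⟨i, 0⟩)) with hB
  have hBfin : ∀ i, (B i).Finite := fun i => (P.finite_subcells _).finite_subsets.image _
  have hBbdd : ∀ i, ∀ A ∈ B i, Bornology.IsBounded A := by
    rintro i _ ⟨C, hC, rfl⟩
    refine (P.isCompact_tileSet ⟨i, 0⟩).isBounded.subset (sUnion_subset fun c hc => ?_)
    exact Prototiles.subset_of_mem_subcells (hC hc)
  set N₀ : Set (Tile d ι) := ⋃ i, ⋃ j, ⋃ A ∈ B i, ⋃ A' ∈ B j,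
    {t | t.label = j ∧ A.Nonempty ∧ A = (fun z => z + t.pos) '' A'} with hN₀
  refine ⟨range (fun i => ⟨i, 0⟩) ∪ N₀, (finite_range _).union ?_, ?_⟩
  · refine finite_iUnion fun i => finite_iUnion fun j => (hBfin i).biUnion fun A _ =>
      (hBfin j).biUnion fun A' hA' => Set.Subsingleton.finite ?_
    rintro t ⟨hl, hne, ht⟩ t' ⟨hl', -, ht'⟩
    ext1
    · rw [hl, hl']
    · refine eq_of_image_add_eq (hBbdd j A' hA') ?_ (ht.symm.trans ht')
      rw [ht] at hne
      exact hne.of_image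
  · intro m T hT t ht t' ht' ⟨z, hz, hz'⟩
    by_cases htt : t = t'
    · left
      exact ⟨t'.label, by rw [htt]; ext1 <;> simp⟩
    right
    have hbdd : Bornology.IsBounded (P.support {t, t'}) := by
      refine ((P.isCompact_tileSet t).isBounded.union (P.isCompact_tileSet t').isBounded).subset ?_
      intro x hx
      obtain ⟨a, ha, hxa⟩ := Prototiles.mem_support.1 hx
      rcases ha with rfl | rfl
      exacts [Or.inl hxa, Or.inr hxa]
    obtain ⟨n, i, u, h⟩ := hT.2 {t, t'} (by rintro a (rfl | rfl) <;> assumption) hbdd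
    have htr : ({⟨i, u⟩} : Set (Tile d ι)) = translate {⟨i, 0⟩} u := by
      simp [translate, Tile.translate]
    rw [htr] at h
    obtain ⟨v, hv⟩ := applyWord_translate F (prefixWord (shift m s) n) {⟨i, 0⟩} u
    rw [hv] at h
    have ha := mem_translate.1 (h (mem_insert t {t'}))
    have ha' := mem_translate.1 (h (mem_insert_of_mem t rfl))
    have haa : t.translate (-v) ≠ t'.translate (-v) := fun hh => htt (by
      simpa using congrArg (fun b => Tile.translate b v) hh)
    obtain ⟨C, hC, hCe⟩ := h_comp i _ _ ha _ ha' haa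
    obtain ⟨C', hC', hCe'⟩ := h_comp i _ _ ha' _ ha haa.symm
    obtain ⟨C₀, hC₀, hCe₀⟩ := exists_sUnion_subcells hC
    obtain ⟨C₀', hC₀', hCe₀'⟩ := exists_sUnion_subcells hC'
    simp only [hN₀, mem_iUnion]
    refine ⟨_, _, _, ⟨C₀, hC₀, rfl⟩, _, ⟨C₀', hC₀', rfl⟩, rfl, ?_, ?_⟩
    · rw [hCe₀, ← hCe, image_nonempty]
      exact ⟨z + -v, P.add_mem_tileSet_translate hz, P.add_mem_tileSet_translate hz'⟩
    · rw [hCe₀, hCe₀', ← hCe, ← hCe', image_image, inter_comm]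
      congr 1
      funext z
      simp only [Tile.translate_pos]
      abel

/-- Finite local complexity makes all tilings in the spaces `Ω_{F,σ^m s}` locally finite. -/
theorem finite_meeting [Finite ι] {F : κ → TileSubstitution P} {s : ℕ → κ}
    (h_flc : P.FLC (hull F s)) (m : ℕ) {T : Set (Tile d ι)} (hT : T ∈ hull F (shift m s))
    {K : Set (Space d)} (hK : Bornology.IsBounded K) :
    {t ∈ T | ∃ z ∈ P.tileSet t, z ∈ K}.Finite := by
  induction m generalizing T K with
  | zero =>
    obtain ⟨D, hD0, hD⟩ := P.exists_dist_le
    set S := {t ∈ T | ∃ z ∈ P.tileSet t, z ∈ K} with hS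
    have hK' : Bornology.IsBounded (Metric.cthickening D K) := hK.cthickening
    have hsub : ∀ t ∈ S, P.tileSet t ⊆ Metric.cthickening D K := by
      rintro t ⟨-, z, hz, hzK⟩ x hx
      exact Metric.mem_cthickening_of_dist_le x z D _ hzK (hD t x hx z hz)
    obtain ⟨Q, hQ, h⟩ := h_flc (Metric.diam (Metric.cthickening D K))
    rcases S.eq_empty_or_nonempty with h0 | ⟨t₀, ht₀⟩
    · rw [h0]; exact finite_empty
    -- With t₀ fixed, t is determined by the class S₀ of the two-tile patch {t₀, t} and by the tiles
    -- y, x of S₀ that correspond to t₀, t.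
    refine Set.Finite.subset (s := ⋃ S₀ ∈ {S₀ ∈ Q | S₀.Finite},
      image2 (fun x y : Tile d ι => x.translate (t₀.pos - y.pos)) S₀ S₀) ?_ ?_
    · exact (hQ.subset (sep_subset _ _)).biUnion fun S₀ hS₀ => hS₀.2.image2 _ hS₀.2
    · intro t ht
      have hsupp : P.support {t₀, t} ⊆ Metric.cthickening D K := by
        intro x hx
        obtain ⟨a, ha, hxa⟩ := Prototiles.mem_support.1 hx
        rcases ha with rfl | rfl
        exacts [hsub _ ht₀ hxa, hsub _ ht hxa]
      obtain ⟨S₀, hS₀, u, hu⟩ := h T hT {t₀, t}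
        (by rintro a (rfl | rfl); exacts [ht₀.1, ht.1])
        (hK'.subset hsupp) (Metric.diam_mono hsupp hK')
      have hfin : S₀.Finite := by
        have hf : (translate S₀ u).Finite := hu ▸ (Set.toFinite _)
        refine Set.Finite.of_finite_image hf fun a _ b _ hab => ?_
        simpa using congrArg (fun c => Tile.translate c (-u)) hab
      obtain ⟨y, hy, hyt⟩ : t₀ ∈ translate S₀ u := hu ▸ mem_insert _ _
      obtain ⟨x, hx, hxt⟩ : t ∈ translate S₀ u := hu ▸ mem_insert_of_mem _ rfl
      simp only [mem_iUnion]
      refine ⟨S₀, ⟨hS₀, hfin⟩, x, hx, y, hy, ?_⟩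
      rw [← hxt, ← hyt]
      simp
  | succ m ih =>
    obtain ⟨D, hD0, hD⟩ := P.exists_dist_le
    set φ := F (s m) with hφ
    have hne : ∀ i, ∃ a, a ∈ φ.img i := fun i => by
      obtain ⟨x, hx⟩ := P.carrier_nonempty i
      obtain ⟨a, ha, -⟩ := φ.mem_support_img_iff.2 hx
      exact ⟨a, ha⟩
    choose a ha using hne
    -- A tile is recovered from its label and one chosen descendant, so local finiteness of φ(T)
    -- gives that of T.
    set f : Tile d ι → Tile d ι × ι :=
      fun t => ((a t.label).translate (φ.ratio • t.pos), t.label) with hf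
    have hK' : Bornology.IsBounded (φ.ratio • Metric.cthickening D K) :=
      (hK.cthickening).smul₀ _
    have hfin := (ih (apply_mem_hull hT) hK').prod (finite_univ (α := ι))
    refine Set.Finite.of_injOn (f := f) ?_ ?_ hfin
    · rintro t ⟨ht, z, hz, hzK⟩
      have hd : (a t.label).translate (φ.ratio • t.pos) ∈ φ.descendants t :=
        translate_mem_translate (ha _) _
      obtain ⟨y, hy⟩ := P.tileSet_nonempty ((a t.label).translate (φ.ratio • t.pos))
      obtain ⟨x, hx, rfl⟩ := φ.exists_smul_of_mem_descendants hd hy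
      refine ⟨⟨φ.mem_apply.2 ⟨t, ht, hd⟩, _, hy, smul_mem_smul_set ?_⟩, mem_univ _⟩
      exact Metric.mem_cthickening_of_dist_le x z D _ hzK (hD t x hx z hz)
    · rintro t - t' - h
      simp only [hf, Prod.mk.injEq] at h
      obtain ⟨h1, h2⟩ := h
      have := congrArg Tile.pos h1
      rw [h2] at this
      simp only [Tile.translate_pos, add_right_inj] at this
      ext1
      · exact h2
      · exact smul_right_injective _ φ.ratio_pos.ne' this

/-! ### Margins around subcells -/

/-- In a tiling `T`, the tiles that come within distance `δ` of a subcell of `t` meet it. -/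
def IsCellMargin (P : Prototiles d ι) (T : Set (Tile d ι)) (t : Tile d ι) (δ : ℝ) : Prop :=
  ∀ c ∈ P.subcells t, ∀ t' ∈ T, (∃ x ∈ c, ∃ y ∈ P.tileSet t', dist x y < δ) →
    ∃ z ∈ P.tileSet t', z ∈ c

theorem IsCellMargin.mono {T : Set (Tile d ι)} {t : Tile d ι} {δ δ' : ℝ}
    (h : IsCellMargin P T t δ) (hδ : δ' ≤ δ) : IsCellMargin P T t δ' :=
  fun c hc t' ht' ⟨x, hx, y, hy, hxy⟩ => h c hc t' ht' ⟨x, hx, y, hy, hxy.trans_le hδ⟩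

/-- Only finitely many tiles come within distance 1 of t, and t has finitely many subcells. Disjoint
compact sets have positive distance, so any δ below 1 and below these finitely many distances works.
-/
theorem exists_isCellMargin [Finite ι] {T : Set (Tile d ι)}
    (hT : ∀ K : Set (Space d), Bornology.IsBounded K → {t ∈ T | ∃ z ∈ P.tileSet t, z ∈ K}.Finite)
    (t : Tile d ι) : ∃ δ > 0, IsCellMargin P T t δ := by
  have hK : Bornology.IsBounded (Metric.cthickening 1 (P.tileSet t)) :=
    (P.isCompact_tileSet t).isBounded.cthickening
  have h1 : ∀ c ∈ P.subcells t, ∀ t' ∈ T, ∃ δ > 0,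
      (∃ x ∈ c, ∃ y ∈ P.tileSet t', dist x y < δ) → ∃ z ∈ P.tileSet t', z ∈ c := by
    intro c hc t' _
    by_cases hd : Disjoint c (P.tileSet t')
    · obtain ⟨δ, hδ, h⟩ := Metric.exists_pos_forall_lt_edist
        (Prototiles.isCompact_of_mem_subcells hc) (P.isCompact_tileSet t').isClosed hd
      refine ⟨δ, NNReal.coe_pos.2 hδ, fun ⟨x, hx, y, hy, hxy⟩ => ?_⟩
      have := h x hx y hy
      rw [edist_nndist, ENNReal.coe_lt_coe, ← NNReal.coe_lt_coe, coe_nndist] at this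
      exact absurd hxy this.not_gt
    · obtain ⟨z, hz, hz'⟩ := not_disjoint_iff.1 hd
      exact ⟨1, one_pos, fun _ => ⟨z, hz', hz⟩⟩
  choose! δ hδ h using h1
  have h2 : ∀ᶠ ε in 𝓝[>] (0 : ℝ), ∀ c ∈ P.subcells t,
      ∀ t' ∈ {t' ∈ T | ∃ z ∈ P.tileSet t', z ∈ Metric.cthickening 1 (P.tileSet t)}, ε < δ c t' := by
    rw [Filter.eventually_all_finite (P.finite_subcells t)]
    intro c hc
    rw [Filter.eventually_all_finite (hT _ hK)]
    intro t' ht'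
    exact nhdsWithin_le_nhds (eventually_lt_nhds (hδ c hc t' ht'.1))
  have h3 : ∀ᶠ ε in 𝓝[>] (0 : ℝ), ε < 1 := nhdsWithin_le_nhds (eventually_lt_nhds one_pos)
  obtain ⟨ε, ⟨h2, h3⟩, h4⟩ := ((h2.and h3).and self_mem_nhdsWithin).exists
  refine ⟨ε, h4, fun c hc t' ht' ⟨x, hx, y, hy, hxy⟩ => ?_⟩
  refine h c hc t' ht' ⟨x, hx, y, hy, hxy.trans (h2 c hc t' ⟨ht', y, hy, ?_⟩)⟩
  refine Metric.mem_cthickening_of_dist_le y x 1 _ (Prototiles.subset_of_mem_subcells hc hx) ?_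
  rw [dist_comm]
  exact (hxy.trans h3).le

/-- The tiles of `T` that touch a tile of `T` touching `t`. -/
def secondCorona (P : Prototiles d ι) (T : Set (Tile d ι)) (t : Tile d ι) : Set (Tile d ι) :=
  {t' ∈ T | ∃ t'' ∈ T, (∃ z ∈ P.tileSet t, z ∈ P.tileSet t'') ∧
    ∃ z ∈ P.tileSet t'', z ∈ P.tileSet t'}

/-- If a tile a of T₂ has a point y within δ of c, the tile b of T₁ at y − v meets c − v by the
margin in T₁. Thus b + v touches both t₂ and a, so a lies in the second corona, is carried back to
T₁, and the margin there applies to it. -/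
theorem IsCellMargin.of_secondCorona {T₁ T₂ : Set (Tile d ι)} {t₁ t₂ : Tile d ι} {v : Space d}
    {δ : ℝ} (h : IsCellMargin P T₁ t₁ δ) (hT₁ : P.IsTiling T₁) (ht₁ : t₁ ∈ T₁)
    (ht : t₂ = t₁.translate v)
    (h₁ : ∀ a ∈ secondCorona P T₁ t₁, a.translate v ∈ T₂)
    (h₂ : ∀ a ∈ secondCorona P T₂ t₂, a.translate (-v) ∈ T₁) : IsCellMargin P T₂ t₂ δ := by
  subst ht
  intro c hc a ha ⟨x, hx, y, hy, hxy⟩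
  have hc' := Prototiles.image_add_mem_subcells hc (-v)
  rw [Tile.translate_translate, add_neg_cancel, Tile.translate_zero] at hc'
  obtain ⟨b, hb, hyb⟩ := hT₁.exists_mem (y - v)
  obtain ⟨z, hz, hzc⟩ := h _ hc' b hb ⟨x + -v, ⟨x, hx, rfl⟩, y - v, hyb, by
    rwa [← sub_eq_add_neg, dist_sub_right]⟩
  have hzt := Prototiles.subset_of_mem_subcells hc' hzc
  have hb2 : b ∈ secondCorona P T₁ t₁ := ⟨hb, t₁, ht₁, ⟨z, hzt, hzt⟩, z, hzt, hz⟩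
  have hb' := h₁ b hb2
  have hyb' : y ∈ P.tileSet (b.translate v) := P.mem_tileSet_translate.2 hyb
  have ha2 : a ∈ secondCorona P T₂ (t₁.translate v) :=
    ⟨ha, _, hb', ⟨z + v, P.add_mem_tileSet_translate hzt, P.add_mem_tileSet_translate hz⟩,
      y, hyb', hy⟩
  have ha' := h₂ a ha2
  obtain ⟨w, hw, hwc⟩ := h _ hc' _ ha' ⟨x + -v, ⟨x, hx, rfl⟩, y + -v,
    P.add_mem_tileSet_translate hy, by rwa [dist_add_right]⟩
  obtain ⟨x', hx', rfl⟩ := hwc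
  exact ⟨x', by simpa [P.mem_tileSet_translate] using hw, hx'⟩

/-- A margin that serves for all tilings in all spaces `Ω_{F,σ^m s}`. -/
theorem exists_uniform_isCellMargin [Finite ι] {F : κ → TileSubstitution P} {s : ℕ → κ}
    (h_flc : P.FLC (hull F s)) (h_comp : IsCompatible F) :
    ∃ δ > 0, ∀ m, ∀ T ∈ hull F (shift m s), ∀ t ∈ T, IsCellMargin P T t δ := by
  obtain ⟨N, hN, h⟩ := exists_finite_touching s h_comp
  set M : Set (Tile d ι) := image2 (fun a b : Tile d ι => b.translate a.pos) N N with hM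
  have hMfin : M.Finite := hN.image2 _ hN
  have hcor : ∀ m, ∀ T ∈ hull F (shift m s), ∀ t ∈ T,
      translate (secondCorona P T t) (-t.pos) ⊆ M := by
    rintro m T hT t ht _ ⟨a, ⟨ha, b, hb, htb, hba⟩, rfl⟩
    refine ⟨_, h m T hT t ht b hb htb, _, h m T hT b hb a ha hba, ?_⟩
    simp only [Tile.translate_translate, Tile.translate_pos]
    congr 1
    abel
  -- Finitely many types of label and second corona; each type that occurs inherits a margin from
  -- one representative, whatever its level.
  set Y : Set (ι × Set (Tile d ι)) := univ ×ˢ 𝒫 M with hY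
  have hYfin : Y.Finite := finite_univ.prod hMfin.finite_subsets
  have hy : ∀ y ∈ Y, ∀ᶠ δ in 𝓝[>] (0 : ℝ), ∀ m, ∀ T ∈ hull F (shift m s), ∀ t ∈ T,
      (t.label, translate (secondCorona P T t) (-t.pos)) = y → IsCellMargin P T t δ := by
    intro y _
    by_cases hex : ∃ m, ∃ T ∈ hull F (shift m s), ∃ t ∈ T,
      (t.label, translate (secondCorona P T t) (-t.pos)) = y
    · obtain ⟨m, T, hT, t, ht, rfl⟩ := hex
      obtain ⟨δ, hδ, hm⟩ := exists_isCellMargin (fun K hK => finite_meeting h_flc m hT hK) t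
      filter_upwards [nhdsWithin_le_nhds (eventually_lt_nhds hδ)] with ε hε
      intro m' T' hT' t' ht' he
      rw [Prod.mk.injEq] at he
      refine (hm.mono hε.le).of_secondCorona (v := t'.pos - t.pos) hT.1 ht ?_ ?_ ?_
      · ext1
        · exact he.1
        · simp
      · intro a ha
        have := translate_mem_translate ha (-t.pos)
        rw [← he.2, mem_translate, Tile.translate_translate,
          show -t.pos + - -t'.pos = t'.pos - t.pos by abel] at this
        exact this.1
      · intro a ha
        have := translate_mem_translate ha (-t'.pos)
        rw [he.2, mem_translate, Tile.translate_translate,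
          show -t'.pos + - -t.pos = -(t'.pos - t.pos) by abel] at this
        exact this.1
    · exact Filter.Eventually.of_forall fun δ m T hT t ht he => absurd ⟨m, T, hT, t, ht, he⟩ hex
  obtain ⟨δ, hδ, hpos⟩ :=
    (((Filter.eventually_all_finite hYfin).2 hy).and self_mem_nhdsWithin).exists
  exact ⟨δ, hpos, fun m T hT t ht => hδ (_, _) ⟨mem_univ _, hcor m T hT t ht⟩ m T hT t ht rfl⟩

/-! ### Products of consecutive substitutions -/

theorem TileSubstitution.comp_assoc (φ ψ χ : TileSubstitution P) :
    (φ.comp ψ).comp χ = φ.comp (ψ.comp χ) := by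
  have h : ∀ i, (φ.comp ψ).apply (χ.img i) = φ.apply (ψ.apply (χ.img i)) := fun i =>
    φ.comp_apply ψ _
  simp only [comp, mk.injEq, mul_assoc, true_and]
  exact funext h

/-- The substitution `φ_{s_m} φ_{s_{m+1}} ⋯ φ_{s_{m+k}}` (a product of `k + 1` factors). -/
def compose (F : κ → TileSubstitution P) (s : ℕ → κ) (m : ℕ) : ℕ → TileSubstitution P
  | 0 => F (s m)
  | k + 1 => (compose F s m k).comp (F (s (m + k + 1)))

/-- `compose` grows at its last factor, whereas commutation with the bonding maps needs the first
factor split off. -/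
theorem comp_compose (F : κ → TileSubstitution P) (s : ℕ → κ) (m k : ℕ) :
    (F (s m)).comp (compose F s (m + 1) k) = compose F s m (k + 1) := by
  induction k with
  | zero => rfl
  | succ k ih =>
    rw [compose, ← TileSubstitution.comp_assoc, ih, compose, compose, compose,
      show m + 1 + k + 1 = m + (k + 1) + 1 by ring]

theorem compose_apply_mem_hull [Finite ι] {F : κ → TileSubstitution P} {s : ℕ → κ} {m k : ℕ}
    {T : Set (Tile d ι)} (hT : T ∈ hull F (shift (m + k + 1) s)) :
    (compose F s m k).apply T ∈ hull F (shift m s) := by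
  induction k generalizing T with
  | zero => exact apply_mem_hull hT
  | succ k ih =>
    rw [compose, TileSubstitution.comp_apply]
    exact ih (apply_mem_hull hT)

/-- As there are finitely many substitutions, the least inflation factor exceeds 1 and its powers
bound the products from below, uniformly in the starting level. -/
theorem exists_lt_ratio_compose [Finite κ] (F : κ → TileSubstitution P) (s : ℕ → κ) (R : ℝ) :
    ∃ k, ∀ m, R < (compose F s m k).ratio := by
  have : Nonempty κ := ⟨s 0⟩
  obtain ⟨j, hj⟩ := Finite.exists_min fun j => (F j).ratio
  obtain ⟨k, hk⟩ := pow_unbounded_of_one_lt R (F j).one_lt_ratio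
  have hpow : ∀ k m, (F j).ratio ^ (k + 1) ≤ (compose F s m k).ratio := by
    intro k m
    induction k with
    | zero =>
      rw [zero_add, pow_one]
      exact hj (s m)
    | succ k ih =>
      rw [pow_succ]
      exact mul_le_mul ih (hj _) (F j).ratio_pos.le ((compose F s m k).ratio_pos.le)
  refine ⟨k, fun m => hk.trans_le ((pow_le_pow_right₀ (F j).one_lt_ratio.le ?_).trans (hpow k m))⟩
  exact Nat.le_succ k

/-! ### Maps induced on the complexes -/

section Induced

variable {Ω Ω₁ Ω₀ : Set (Set (Tile d ι))}

/-- The map `(T, u) ↦ (φ(T), ratio • u)`. -/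
def substMap (φ : TileSubstitution P) (hφ : ∀ T ∈ Ω₁, φ.apply T ∈ Ω₀)
    (x : Discrete Ω₁ × Space d) : Discrete Ω₀ × Space d :=
  (⟨φ.apply x.1.val, hφ _ x.1.property⟩, φ.ratio • x.2)

theorem continuous_substMap (φ : TileSubstitution P) (hφ : ∀ T ∈ Ω₁, φ.apply T ∈ Ω₀) :
    Continuous (substMap φ hφ) := by
  have : DiscreteTopology (Discrete Ω₁) := ⟨rfl⟩
  have h : Continuous fun x : Discrete Ω₁ × Space d => φ.ratio • x.2 :=
    (continuous_const_smul φ.ratio).comp continuous_snd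
  let g : Discrete Ω₁ → Discrete Ω₀ := fun T => ⟨φ.apply T.val, hφ _ T.property⟩
  exact ((continuous_of_discreteTopology (f := g)).comp continuous_fst).prodMk h

theorem exists_continuousMap_quotient {A B : Type*} [TopologicalSpace A] [TopologicalSpace B]
    {r : A → A → Prop} {r' : B → B → Prop} (f : A → B) (hf : Continuous f)
    (h : ∀ x y, r x y → Relation.EqvGen r' (f x) (f y)) :
    ∃ γ : C(Quotient (Relation.EqvGen.setoid r), Quotient (Relation.EqvGen.setoid r')),
      ∀ x, γ (Quotient.mk _ x) = Quotient.mk _ (f x) := by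
  have h' : ∀ x y, Relation.EqvGen r x y → Relation.EqvGen r' (f x) (f y) := by
    intro x y hxy
    induction hxy with
    | rel x y hxy => exact h x y hxy
    | refl x => exact .refl _
    | symm x y _ ih => exact .symm _ _ ih
    | trans x y z _ _ ih₁ ih₂ => exact .trans _ _ _ ih₁ ih₂
  have hc : Continuous fun x => Quotient.mk (Relation.EqvGen.setoid r') (f x) :=
    continuous_quotient_mk'.comp hf
  exact ⟨⟨Quotient.lift _ fun x y hxy => Quotient.sound (h' x y hxy), hc.quotient_lift _⟩,
    fun _ => rfl⟩

/-- A descendant a of t through the inflated point lies in the inflated t, so tiles meeting a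
descend from tiles meeting t: the collar of t determines that of a. -/
theorem exists_isInducedAP (φ : TileSubstitution P) (hφ : ∀ T ∈ Ω₁, φ.apply T ∈ Ω₀) :
    ∃ γ : C(AP P Ω₁, AP P Ω₀), IsInducedAP φ γ := by
  obtain ⟨γ, hγ⟩ := exists_continuousMap_quotient (r := collarRel P Ω₁) (r' := collarRel P Ω₀)
    (substMap φ hφ) (continuous_substMap φ hφ) (by
      intro x y hxy
      obtain ⟨t, ht, hx, h⟩ := collarRel_iff.1 hxy
      obtain ⟨a, hat, ha⟩ := φ.mem_tileSet_iff.1 hx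
      refine .rel _ _ (collarRel_iff.2 ⟨a, φ.mem_apply.2 ⟨t, ht, hat⟩, ha, ?_⟩)
      have := h.apply_of_subset_smul φ (φ.tileSet_subset_smul hat)
      rwa [smul_sub] at this)
  exact ⟨γ, fun T hT => ⟨hφ T hT, fun u => hγ (⟨T, hT⟩, u)⟩⟩

/-- The image under a substitution of a subcell of a tile is covered by subcells that lie in it. -/
theorem RespectsCells.exists_subcell {F : κ → TileSubstitution P} (h : RespectsCells F) (r : κ)
    {t : Tile d ι} {c : Set (Space d)} (hc : c ∈ P.subcells t) {x : Space d} (hx : x ∈ c) :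
    ∃ a ∈ (F r).descendants t, ∃ e ∈ P.subcells a,
      (F r).ratio • x ∈ e ∧ e ⊆ (F r).ratio • c := by
  have hc' := Prototiles.image_add_mem_subcells hc (-t.pos)
  rw [show t.translate (-t.pos) = ⟨t.label, 0⟩ by ext1 <;> simp] at hc'
  obtain ⟨C, hC, hCe⟩ := h r t.label _ hc'
  have hx' : (F r).ratio • (x + -t.pos) ∈ ⋃₀ C := by
    rw [← hCe]
    exact smul_mem_smul_set ⟨x, hx, rfl⟩
  obtain ⟨e, he, hxe⟩ := hx'
  have he' := hC he
  simp only [mem_iUnion] at he'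
  obtain ⟨a, ha, hea⟩ := he'
  refine ⟨_, translate_mem_translate ha _, _, Prototiles.image_add_mem_subcells hea _,
    ⟨_, hxe, ?_⟩, ?_⟩
  · simp [smul_add]
  · rintro _ ⟨y, hy, rfl⟩
    obtain ⟨_, ⟨z, hz, rfl⟩, rfl⟩ : y ∈ (F r).ratio • ((fun y => y + -t.pos) '' c) :=
      hCe ▸ mem_sUnion_of_mem hy he
    exact ⟨z, hz, by simp [smul_add]⟩

theorem exists_isInducedModAP {F : κ → TileSubstitution P} (h_cell : RespectsCells F) (r : κ)
    (hφ : ∀ T ∈ Ω₁, (F r).apply T ∈ Ω₀) :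
    ∃ γ : C(ModAP P Ω₁, ModAP P Ω₀), IsInducedModAP (F r) γ := by
  obtain ⟨γ, hγ⟩ := exists_continuousMap_quotient
    (r := cellCollarRel P Ω₁) (r' := cellCollarRel P Ω₀)
    (substMap (F r) hφ) (continuous_substMap (F r) hφ) (by
      intro x y hxy
      obtain ⟨t, ht, c, hc, hx, h⟩ := cellCollarRel_iff.1 hxy
      obtain ⟨a, hat, e, he, hxe, hec⟩ := h_cell.exists_subcell r hc hx
      refine .rel _ _ (cellCollarRel_iff.2
        ⟨a, (F r).mem_apply.2 ⟨t, ht, hat⟩, e, he, hxe, ?_⟩)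
      have := h.apply_of_subset_smul (F r) hec
      rwa [smul_sub] at this)
  exact ⟨γ, fun T hT => ⟨hφ T hT, fun u => hγ (⟨T, hT⟩, u)⟩⟩

/-- The projection from the Anderson-Putnam complex to the modified one. -/
theorem exists_AP_to_ModAP (P : Prototiles d ι) (Ω : Set (Set (Tile d ι))) :
    ∃ g : C(AP P Ω, ModAP P Ω), ∀ T hT u, g (AP.mk P T hT u) = ModAP.mk P T hT u := by
  obtain ⟨g, hg⟩ := exists_continuousMap_quotient
    (r := collarRel P Ω) (r' := cellCollarRel P Ω) id continuous_id (by
      intro x y hxy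
      obtain ⟨t, ht, hx, h⟩ := collarRel_iff.1 hxy
      obtain ⟨c, hc, hxc⟩ := Prototiles.exists_mem_subcells hx
      exact .rel _ _ (cellCollarRel_iff.2
        ⟨t, ht, c, hc, hxc, h.mono (Prototiles.subset_of_mem_subcells hc)⟩))
  exact ⟨g, fun T hT u => hg (⟨T, hT⟩, u)⟩

/-- A substitution with a large inflation factor maps the modified Anderson-Putnam complex to the
unmodified one. -/
theorem exists_ModAP_to_AP (φ : TileSubstitution P) (hφ : ∀ T ∈ Ω₁, φ.apply T ∈ Ω₀)
    {D δ : ℝ} (hD : ∀ t : Tile d ι, ∀ x ∈ P.tileSet t, ∀ y ∈ P.tileSet t, dist x y ≤ D)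
    (hδ : ∀ T ∈ Ω₁, ∀ t ∈ T, IsCellMargin P T t δ) (hlt : D < φ.ratio * δ) :
    ∃ b : C(ModAP P Ω₁, AP P Ω₀), ∀ T (hT : T ∈ Ω₁) u,
      b (ModAP.mk P T hT u) = AP.mk P (φ.apply T) (hφ T hT) (φ.ratio • u) := by
  obtain ⟨γ, hγ⟩ := exists_continuousMap_quotient
    (r := cellCollarRel P Ω₁) (r' := collarRel P Ω₀)
    (substMap φ hφ) (continuous_substMap φ hφ) (by
      intro x y hxy
      obtain ⟨t, ht, c, hc, hx, h⟩ := cellCollarRel_iff.1 hxy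
      have hxt := Prototiles.subset_of_mem_subcells hc hx
      obtain ⟨a, hat, ha⟩ := φ.mem_tileSet_iff.1 hxt
      -- The diameter of a is at most D < λδ, so deflated it lies in the δ-ball about the base
      -- point. A tile with a descendant meeting a therefore comes within δ of c and meets c.
      have hdist : ∀ z, φ.ratio • z ∈ P.tileSet a → dist x.2 z < δ := by
        intro z hz
        have := (hD a _ ha _ hz).trans_lt hlt
        rw [dist_smul₀, Real.norm_of_nonneg φ.ratio_pos.le] at this
        exact lt_of_mul_lt_mul_left this φ.ratio_pos.le
      refine .rel _ _ (collarRel_iff.2 ⟨a, φ.mem_apply.2 ⟨t, ht, hat⟩, ha, ?_⟩)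
      have := h.apply φ (V := P.tileSet a) ?_ ?_
      · rwa [smul_sub] at this
      · rintro t' ht' ⟨z, hz, hza⟩
        exact hδ _ x.1.property t ht c hc t' ht' ⟨x.2, hx, z, hz, hdist z hza⟩
      · rintro t' ht' ⟨z, hz, hza⟩
        have hd := hdist _ hza
        rw [← dist_add_right _ _ (y.2 - x.2), sub_add_cancel] at hd
        -- In the second tiling the margin is applied to the translate of c, a subcell of the
        -- translate of t, which agreement places there.
        obtain ⟨w, hw, w', hw', rfl⟩ := hδ _ y.1.property _ (h.1 t ht ⟨_, hxt, hx⟩) _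
          (Prototiles.image_add_mem_subcells hc _) t' ht' ⟨_, ⟨x.2, hx, rfl⟩, z, hz, hd⟩
        exact ⟨_, hw, by simpa using hw'⟩)
  exact ⟨γ, fun T hT u => hγ (⟨T, hT⟩, u)⟩

theorem AP.exists_eq_mk (x : AP P Ω) : ∃ T, ∃ hT : T ∈ Ω, ∃ u, x = AP.mk P T hT u := by
  obtain ⟨⟨⟨T, hT⟩, u⟩, rfl⟩ := Quotient.exists_rep x
  exact ⟨T, hT, u, rfl⟩

theorem ModAP.exists_eq_mk (x : ModAP P Ω) : ∃ T, ∃ hT : T ∈ Ω, ∃ u, x = ModAP.mk P T hT u := by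
  obtain ⟨⟨⟨T, hT⟩, u⟩, rfl⟩ := Quotient.exists_rep x
  exact ⟨T, hT, u, rfl⟩

end Induced

/-! ### Interleaving and inverse limits -/

/-- Two inverse systems that interleave have homeomorphic inverse limits. -/
theorem nonempty_inverseLimit_homeomorph {X Y : ℕ → Type*} [∀ i, TopologicalSpace (X i)]
    [∀ i, TopologicalSpace (Y i)] (f : ∀ i, C(X (i + 1), X i)) (g : ∀ i, C(Y (i + 1), Y i))
    (e : ℕ → ℕ) (a : ∀ i, C(Y i, X i)) (b : ∀ i, C(X (e i), Y i))
    (ha : ∀ y ∈ InverseLimit g, ∀ i, f i (a (i + 1) (y (i + 1))) = a i (y i))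
    (hb : ∀ x ∈ InverseLimit f, ∀ i, g i (b (i + 1) (x (e (i + 1)))) = b i (x (e i)))
    (hab : ∀ x ∈ InverseLimit f, ∀ i, a i (b i (x (e i))) = x i)
    (hba : ∀ y ∈ InverseLimit g, ∀ i, b i (a (e i) (y (e i))) = y i) :
    Nonempty (InverseLimit f ≃ₜ InverseLimit g) := by
  refine ⟨{
    toFun := fun x => ⟨fun i => b i (x.1 (e i)), hb x.1 x.2⟩
    invFun := fun y => ⟨fun i => a i (y.1 i), ha y.1 y.2⟩
    left_inv := fun x => Subtype.ext (funext (hab x.1 x.2))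
    right_inv := fun y => Subtype.ext (funext (hba y.1 y.2))
    continuous_toFun := ?_
    continuous_invFun := ?_ }⟩
  · exact (continuous_pi fun i => (b i).continuous.comp
      ((continuous_apply (e i)).comp continuous_subtype_val)).subtype_mk _
  · exact (continuous_pi fun i => (a i).continuous.comp
      ((continuous_apply i).comp continuous_subtype_val)).subtype_mk _

section Limit

variable [Finite ι] {F : κ → TileSubstitution P} {s : ℕ → κ}

/-- A representative chosen at a high level of a thread yields explicit ones below, so that a map
descending k+1 levels can be recognised as the identity on threads. -/
theorem AP.eq_mk_compose {γ : ∀ i, C(AP P (hull F (shift (i + 1) s)), AP P (hull F (shift i s)))}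
    (hγ : ∀ i, IsInducedAP (F (s i)) (γ i))
    {y : ∀ i, AP P (hull F (shift i s))} (hy : ∀ i, γ i (y (i + 1)) = y i) {m k : ℕ}
    {T : Set (Tile d ι)} {hT : T ∈ hull F (shift (m + k + 1) s)} {u : Space d}
    (h : y (m + k + 1) = AP.mk P T hT u) :
    y m = AP.mk P ((compose F s m k).apply T) (compose_apply_mem_hull hT)
      ((compose F s m k).ratio • u) := by
  induction k generalizing T u with
  | zero =>
    rw [← hy m]
    exact (congrArg (γ m) h).trans ((hγ m T hT).2 u)
  | succ k ih =>
    have := ih ((hy (m + k + 1)).symm.trans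
      ((congrArg (γ (m + k + 1)) h).trans ((hγ (m + k + 1) T hT).2 u)))
    simp only [compose, TileSubstitution.comp_apply]
    rw [this, smul_smul]
    rfl

theorem ModAP.eq_mk_compose
    {γ : ∀ i, C(ModAP P (hull F (shift (i + 1) s)), ModAP P (hull F (shift i s)))}
    (hγ : ∀ i, IsInducedModAP (F (s i)) (γ i))
    {y : ∀ i, ModAP P (hull F (shift i s))} (hy : ∀ i, γ i (y (i + 1)) = y i) {m k : ℕ}
    {T : Set (Tile d ι)} {hT : T ∈ hull F (shift (m + k + 1) s)} {u : Space d}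
    (h : y (m + k + 1) = ModAP.mk P T hT u) :
    y m = ModAP.mk P ((compose F s m k).apply T) (compose_apply_mem_hull hT)
      ((compose F s m k).ratio • u) := by
  induction k generalizing T u with
  | zero =>
    rw [← hy m]
    exact (congrArg (γ m) h).trans ((hγ m T hT).2 u)
  | succ k ih =>
    have := ih ((hy (m + k + 1)).symm.trans
      ((congrArg (γ (m + k + 1)) h).trans ((hγ (m + k + 1) T hT).2 u)))
    simp only [compose, TileSubstitution.comp_apply]
    rw [this, smul_smul]
    rfl

end Limit

end MixedTiling

/-- For a mixed substitution space of tilings of `ℝ^d` that satisfies the four standing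
conditions, the substitutions induce continuous maps between the Anderson-Putnam complexes and
between the modified Anderson-Putnam complexes of the spaces `Ω_{F,σ^i s}`, and the two inverse
limits are homeomorphic. -/
theorem mainTheorem1 {d : ℕ} {ι κ : Type*} [Finite ι] [Finite κ]
    (P : MixedTiling.Prototiles d ι) (F : κ → MixedTiling.TileSubstitution P) (s : ℕ → κ)
    (h_inj : MixedTiling.InjectiveSystem F s)
    (h_prim : MixedTiling.IsPrimitive F s)
    (h_flc : P.FLC (MixedTiling.hull F s))
    (h_comp : MixedTiling.IsCompatible F)
    (h_cell : MixedTiling.RespectsCells F) :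
    ∃ (γ : ∀ i : ℕ, C(MixedTiling.AP P (MixedTiling.hull F (MixedTiling.shift (i + 1) s)),
          MixedTiling.AP P (MixedTiling.hull F (MixedTiling.shift i s))))
      (γ' : ∀ i : ℕ, C(MixedTiling.ModAP P (MixedTiling.hull F (MixedTiling.shift (i + 1) s)),
          MixedTiling.ModAP P (MixedTiling.hull F (MixedTiling.shift i s)))),
      (∀ i, MixedTiling.IsInducedAP (F (s i)) (γ i)) ∧
      (∀ i, MixedTiling.IsInducedModAP (F (s i)) (γ' i)) ∧
      Nonempty (MixedTiling.InverseLimit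
          (X := fun i => MixedTiling.ModAP P (MixedTiling.hull F (MixedTiling.shift i s))) γ' ≃ₜ
        MixedTiling.InverseLimit
          (X := fun i => MixedTiling.AP P (MixedTiling.hull F (MixedTiling.shift i s))) γ) := by
  obtain ⟨D, -, hD⟩ := P.exists_dist_le
  obtain ⟨δ, hδ, hmargin⟩ := MixedTiling.exists_uniform_isCellMargin h_flc h_comp
  obtain ⟨k, hk⟩ := MixedTiling.exists_lt_ratio_compose F s (D / δ)
  choose γ hγ using fun i => MixedTiling.exists_isInducedAP (F (s i))
    (Ω₁ := MixedTiling.hull F (MixedTiling.shift (i + 1) s))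
    (Ω₀ := MixedTiling.hull F (MixedTiling.shift i s)) fun T hT => MixedTiling.apply_mem_hull hT
  choose γ' hγ' using fun i => MixedTiling.exists_isInducedModAP h_cell (s i)
    (Ω₁ := MixedTiling.hull F (MixedTiling.shift (i + 1) s))
    (Ω₀ := MixedTiling.hull F (MixedTiling.shift i s)) fun T hT => MixedTiling.apply_mem_hull hT
  choose a ha using fun i =>
    MixedTiling.exists_AP_to_ModAP P (MixedTiling.hull F (MixedTiling.shift i s))
  choose b hb using fun i => MixedTiling.exists_ModAP_to_AP (MixedTiling.compose F s i k)
    (Ω₁ := MixedTiling.hull F (MixedTiling.shift (i + k + 1) s))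
    (Ω₀ := MixedTiling.hull F (MixedTiling.shift i s))
    (fun T hT => MixedTiling.compose_apply_mem_hull hT) hD (hmargin _)
    ((div_lt_iff₀ hδ).1 (hk i))
  refine ⟨γ, γ', hγ, hγ',
    MixedTiling.nonempty_inverseLimit_homeomorph γ' γ (fun i => i + k + 1) a b ?_ ?_ ?_ ?_⟩
  · intro y hy i
    obtain ⟨T, hT, u, h⟩ := MixedTiling.AP.exists_eq_mk (y (i + 1))
    rw [← hy i, h, ha, ((hγ' i) T hT).2, ((hγ i) T hT).2, ha]
  · intro x hx i
    obtain ⟨T, hT, u, h⟩ := MixedTiling.ModAP.exists_eq_mk (x (i + k + 1 + 1))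
    -- The levels i + k + 1 + 1 and i + 1 + k + 1 agree only after arithmetic, so the representative
    -- is transported.
    have htr : ∀ j, j = i + k + 1 + 1 →
        ∃ hT : T ∈ MixedTiling.hull F (MixedTiling.shift j s),
          x j = MixedTiling.ModAP.mk P T hT u := by
      rintro j rfl
      exact ⟨hT, h⟩
    obtain ⟨hT', h'⟩ := htr (i + 1 + k + 1) (by ring)
    -- Both sides apply the same product of k + 2 substitutions, with either the first or the last
    -- factor split off.
    have hcomp := congrArg (fun φ => (φ.apply T, φ.ratio)) (MixedTiling.comp_compose F s i k)
    simp only [MixedTiling.compose, MixedTiling.TileSubstitution.comp_apply,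
      Prod.mk.injEq] at hcomp
    rw [← hx (i + k + 1), h, ((hγ' (i + k + 1)) T hT).2, hb, h', hb, ((hγ i) _ _).2]
    simp only [hcomp.1, smul_smul]
    congr 2
    exact hcomp.2
  · intro x hx i
    obtain ⟨T, hT, u, h⟩ := MixedTiling.ModAP.exists_eq_mk (x (i + k + 1))
    rw [MixedTiling.ModAP.eq_mk_compose hγ' hx h, h, hb, ha]
  · intro y hy i
    obtain ⟨T, hT, u, h⟩ := MixedTiling.AP.exists_eq_mk (y (i + k + 1))
    rw [MixedTiling.AP.eq_mk_compose hγ hy h, h, ha, hb]
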